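/- All outcome spaces are locally compact second countable Hausdorff spaces with their Borel $\sigma$-algebras, and $\mathcal H$ is a complex separable Hilbert space. An observable $E$ on $\Omega$ with values in $\mathcal H$ is a normalized positive operator valued measure: $E(X)\ge 0$ is a bounded operator on $\mathcal H$ for every Borel set $X\subseteq\Omega$, $E(\Omega)=I$, and $E$ is countably additive in the weak operator topology. It is sharp (a projection valued measure) if $E(X)E(Y)=E(X\cap Y)$ for all Borel sets $X,Y$. For a state $T$ (a positive operator on $\mathcal H$ of trace one), $p^E_T(X)=\operatorname{tr}(T\,E(X))$ denotes the outcome distribution. An observable $E$ on $\Omega_1$ is a fuzzy version of an observable $F$ on $\Omega_2$ if there is a Markov kernel $\mu$ from $\Omega_2$ to $\Omega_1$ (each $\mu_x$ is a Borel probability measure on $\Omega_1$ and $x\mapsto\mu_x(X)$ is measurable for each Borel set $X\subseteq\Omega_1$) such that $$p^E_T(X)=\int_{\Omega_2}\mu_x(X)\,dp^F_T(x)\qquad\text{for all Borel sets }X\subseteq\Omega_1\text{ and all states }T.$$ **Proposition.** Let $P_1$ and $P_2$ be sharp observables on $\Omega_1$ and $\Omega_2$, respectively, with values in the same Hilbert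 space $\mathcal H$. If $P_1$ is a fuzzy version of $P_2$, then there exists a measurable function $\Phi:\Omega_2\to\Omega_1$ such that $P_1=P_2\circ\Phi^{-1}$, that is, $P_1(X)=P_2(\Phi^{-1}(X))$ for every Borel set $X\subseteq\Omega_1$. -/

import Mathlib

open MeasureTheory ProbabilityTheory
open scoped InnerProductSpace

namespace Quantum

section Operators

variable {H : Type*} [NormedAddCommGroup H] [InnerProductSpace ℂ H] [CompleteSpace H]

/-- The index set of a fixed orthonormal (Hilbert) basis of `H`. -/
def stdIndex (H : Type*) [NormedAddCommGroup H] [InnerProductSpace ℂ H] [CompleteSpace H] :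
    Set H :=
  (exists_hilbertBasis ℂ H).choose

/-- A fixed orthonormal (Hilbert) basis of `H`, used to compute traces. -/
noncomputable def stdBasis (H : Type*) [NormedAddCommGroup H] [InnerProductSpace ℂ H]
    [CompleteSpace H] : HilbertBasis (stdIndex H) ℂ H :=
  (exists_hilbertBasis ℂ H).choose_spec.choose

/-- The trace `∑ᵢ ⟪eᵢ, A eᵢ⟫` of an operator. It is only used for positive operators and for
products of a positive trace class operator with a bounded operator; for the former a divergent
series has junk value `0`, which is never confused with trace one. -/
noncomputable def opTrace (A : H →L[ℂ] H) : ℂ :=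
  ∑' i, ⟪stdBasis H i, A (stdBasis H i)⟫_ℂ

/-- States: positive operators of trace one. -/
structure DensityOperator (H : Type*) [NormedAddCommGroup H] [InnerProductSpace ℂ H]
    [CompleteSpace H] where
  /-- The underlying bounded operator. -/
  op : H →L[ℂ] H
  isPositive : op.IsPositive
  trace_eq_one : opTrace op = 1

/-- The positive square root of a state. -/
noncomputable def DensityOperator.sqrt (T : DensityOperator H) : H →L[ℂ] H :=
  CFC.sqrt T.op

lemma DensityOperator.sqrt_isPositive (T : DensityOperator H) : T.sqrt.IsPositive :=
  (ContinuousLinearMap.nonneg_iff_isPositive _).1 (CFC.sqrt_nonneg _)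

lemma DensityOperator.sqrt_sqrt (T : DensityOperator H) (x : H) :
    T.sqrt (T.sqrt x) = T.op x := by
  have h : CFC.sqrt T.op * CFC.sqrt T.op = T.op :=
    CFC.sqrt_mul_sqrt_self _ ((ContinuousLinearMap.nonneg_iff_isPositive _).2 T.isPositive)
  exact congrArg (fun A : H →L[ℂ] H => A x) h

lemma DensityOperator.inner_sqrt (T : DensityOperator H) (x y : H) :
    ⟪T.sqrt x, y⟫_ℂ = ⟪x, T.sqrt y⟫_ℂ :=
  T.sqrt_isPositive.isSymmetric x y

lemma DensityOperator.hasSum_norm_sq (T : DensityOperator H) :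
    HasSum (fun i => ‖T.sqrt (stdBasis H i)‖ ^ 2) 1 := by
  have h1 : Summable fun i => ⟪stdBasis H i, T.op (stdBasis H i)⟫_ℂ := by
    by_contra h
    have := T.trace_eq_one
    rw [opTrace, tsum_eq_zero_of_not_summable h] at this
    exact zero_ne_one this
  have h2 := h1.hasSum
  rw [show (∑' i, ⟪stdBasis H i, T.op (stdBasis H i)⟫_ℂ) = 1 from T.trace_eq_one] at h2
  have h3 := Complex.hasSum_re h2
  convert h3 using 1
  · ext i
    rw [← T.sqrt_sqrt, ← T.inner_sqrt, inner_self_eq_norm_sq_to_K]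
    norm_cast
  · simp

lemma hasSum_norm_inner_sq (x : H) :
    HasSum (fun i => ‖⟪stdBasis H i, x⟫_ℂ‖ ^ 2) (‖x‖ ^ 2) := by
  have h := Complex.hasSum_re ((stdBasis H).hasSum_inner_mul_inner x x)
  rw [inner_self_eq_norm_sq_to_K] at h
  convert h using 1
  · ext i
    rw [← inner_conj_symm x, Complex.conj_mul']
    norm_cast
  · norm_cast

/-- For a state `T` and a bounded operator `A`, the trace of `T A` is the absolutely convergent
sum of the numbers `⟪√T eᵢ, A √T eᵢ⟫`. -/
lemma DensityOperator.hasSum_opTrace (T : DensityOperator H) (A : H →L[ℂ] H) :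
    HasSum (fun i => ⟪T.sqrt (stdBasis H i), A (T.sqrt (stdBasis H i))⟫_ℂ)
      (opTrace (T.op ∘L A)) := by
  have hs := T.hasSum_norm_sq.summable
  let B : H →L[ℂ] H := ContinuousLinearMap.adjoint A
  let f : stdIndex H × stdIndex H → ℂ := fun p =>
    ⟪B (T.sqrt (stdBasis H p.1)), stdBasis H p.2⟫_ℂ *
      ⟪stdBasis H p.2, T.sqrt (stdBasis H p.1)⟫_ℂ
  have hb : ∀ u : stdIndex H → H, Summable (fun i => ‖u i‖ ^ 2) →
      Summable fun p : stdIndex H × stdIndex H => ‖⟪stdBasis H p.2, u p.1⟫_ℂ‖ ^ 2 := by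
    intro u hu
    refine (summable_prod_of_nonneg fun _ => by positivity).2
      ⟨fun i => (hasSum_norm_inner_sq (u i)).summable, ?_⟩
    simpa only [(hasSum_norm_inner_sq _).tsum_eq] using hu
  have hB : Summable fun i => ‖B (T.sqrt (stdBasis H i))‖ ^ 2 := by
    refine Summable.of_nonneg_of_le (fun _ => by positivity) (fun i => ?_)
      (hs.mul_left (‖B‖ ^ 2))
    rw [← mul_pow]
    gcongr
    exact B.le_opNorm _
  have hf : Summable f := by
    refine Summable.of_norm_bounded
      ((hb (fun i => T.sqrt (stdBasis H i)) hs).add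
        (hb (fun i => B (T.sqrt (stdBasis H i))) hB)) fun p => ?_
    rw [norm_mul, norm_inner_symm]
    nlinarith [sq_nonneg (‖⟪stdBasis H p.2, T.sqrt (stdBasis H p.1)⟫_ℂ‖ -
      ‖⟪stdBasis H p.2, B (T.sqrt (stdBasis H p.1))⟫_ℂ‖),
      sq_nonneg ‖⟪stdBasis H p.2, T.sqrt (stdBasis H p.1)⟫_ℂ‖,
      sq_nonneg ‖⟪stdBasis H p.2, B (T.sqrt (stdBasis H p.1))⟫_ℂ‖]
  have h1 := hf.hasSum.prod_fiberwise fun i =>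
    (stdBasis H).hasSum_inner_mul_inner (B (T.sqrt (stdBasis H i))) (T.sqrt (stdBasis H i))
  have h2 := ((Equiv.prodComm _ _).hasSum_iff.2 hf.hasSum).prod_fiberwise
    (g := fun i => ⟪stdBasis H i, T.op (A (stdBasis H i))⟫_ℂ) fun i => by
      have h := (stdBasis H).hasSum_inner_mul_inner (T.sqrt (stdBasis H i))
        (T.sqrt (A (stdBasis H i)))
      rw [T.inner_sqrt, T.sqrt_sqrt] at h
      refine (congrArg (HasSum · _) (funext fun j => ?_)).mp h
      symm
      change ⟪B (T.sqrt (stdBasis H j)), stdBasis H i⟫_ℂ *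
        ⟪stdBasis H i, T.sqrt (stdBasis H j)⟫_ℂ = _
      rw [ContinuousLinearMap.adjoint_inner_left, T.inner_sqrt, T.inner_sqrt (stdBasis H i),
        mul_comm]
  have h3 : opTrace (T.op ∘L A) = ∑' p, f p := h2.tsum_eq
  rw [h3]
  refine (congrArg (HasSum · _) (funext fun i => ?_)).mp h1
  rw [ContinuousLinearMap.adjoint_inner_left]

end Operators

section Observables

open scoped ComplexOrder

variable {Ω : Type*} [MeasurableSpace Ω]
  {H : Type*} [NormedAddCommGroup H] [InnerProductSpace ℂ H] [CompleteSpace H]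

/-- A (normalized) positive operator valued measure on `Ω` with values in `H`: a measure with
values in the bounded operators on `H`, countably additive in the weak operator topology, positive
and with `E Ω = 1`. -/
structure POVM (Ω : Type*) [MeasurableSpace Ω] (H : Type*) [NormedAddCommGroup H]
    [InnerProductSpace ℂ H] [CompleteSpace H] where
  /-- The underlying operator valued measure. -/
  toVectorMeasure : VectorMeasure Ω (H →WOT[ℂ] H)
  isPositive' : ∀ X, MeasurableSet X → (toVectorMeasure X).toCLM.IsPositive
  univ' : (toVectorMeasure Set.univ).toCLM = 1

/-- The bounded operator `E X` that a POVM `E` assigns to a set `X`. -/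
noncomputable def POVM.effect (E : POVM Ω H) (X : Set Ω) : H →L[ℂ] H :=
  (E.toVectorMeasure X).toCLM

/-- A POVM is sharp (a projection valued measure) if it is multiplicative:
`E X * E Y = E (X ∩ Y)`. -/
def POVM.IsSharp (E : POVM Ω H) : Prop :=
  ∀ X Y, MeasurableSet X → MeasurableSet Y → E.effect X * E.effect Y = E.effect (X ∩ Y)

lemma POVM.isPositive (E : POVM Ω H) (X : Set Ω) : (E.effect X).IsPositive := by
  by_cases hX : MeasurableSet X
  · exact E.isPositive' X hX
  · rw [effect, E.toVectorMeasure.not_measurable hX]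
    exact ContinuousLinearMap.isPositive_zero

lemma POVM.hasSum_inner (E : POVM Ω H) {X : ℕ → Set Ω} (hX : ∀ n, MeasurableSet (X n))
    (hd : Pairwise (Function.onFun Disjoint X)) (x y : H) :
    HasSum (fun n => ⟪y, E.effect (X n) x⟫_ℂ) ⟪y, E.effect (⋃ n, X n) x⟫_ℂ := by
  have h := (ContinuousLinearMapWOT.tendsto_iff_forall_inner_apply_tendsto.1
    (E.toVectorMeasure.m_iUnion hX hd)) x y
  refine h.congr fun s => ?_
  induction s using Finset.cons_induction with
  | empty => simp
  | cons a s ha ih =>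
    rw [Finset.sum_cons, Finset.sum_cons, ContinuousLinearMapWOT.add_apply, inner_add_right, ih]
    rfl

lemma POVM.ofReal_opTrace (E : POVM Ω H) (T : DensityOperator H) (X : Set Ω) :
    ENNReal.ofReal (opTrace (T.op ∘L E.effect X)).re =
      ∑' i, ENNReal.ofReal
        (⟪T.sqrt (stdBasis H i), E.effect X (T.sqrt (stdBasis H i))⟫_ℂ).re := by
  have h := Complex.hasSum_re (T.hasSum_opTrace (E.effect X))
  rw [← h.tsum_eq]
  exact ENNReal.ofReal_tsum_of_nonneg
    (fun i => (E.isPositive X).re_inner_nonneg_right _) h.summable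

/-- The distribution `X ↦ tr (T E(X))` of the outcomes of the observable `E` in the state `T`. -/
noncomputable def POVM.outcomeMeasure (E : POVM Ω H) (T : DensityOperator H) : Measure Ω :=
  Measure.ofMeasurable (fun X _ => ENNReal.ofReal (opTrace (T.op ∘L E.effect X)).re)
    (by simp [POVM.effect, opTrace])
    (by
      intro X hX hd
      simp only [E.ofReal_opTrace]
      rw [ENNReal.tsum_comm]
      refine tsum_congr fun i => ?_
      have h := Complex.hasSum_re (E.hasSum_inner hX hd (T.sqrt (stdBasis H i))
        (T.sqrt (stdBasis H i)))
      rw [← h.tsum_eq]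
      exact ENNReal.ofReal_tsum_of_nonneg
        (fun n => (E.isPositive (X n)).re_inner_nonneg_right _) h.summable)

/-- The outcome distribution is given by the trace formula; in particular the trace is a
nonnegative real number. -/
lemma POVM.outcomeMeasure_apply (E : POVM Ω H) (T : DensityOperator H) {X : Set Ω}
    (hX : MeasurableSet X) :
    E.outcomeMeasure T X ≠ ⊤ ∧
      ((E.outcomeMeasure T X).toReal : ℂ) = opTrace (T.op ∘L E.effect X) := by
  have hp := fun i => (E.isPositive X).inner_nonneg_right (T.sqrt (stdBasis H i))
  have h0 : 0 ≤ opTrace (T.op ∘L E.effect X) := (T.hasSum_opTrace (E.effect X)).nonneg hp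
  rw [outcomeMeasure, Measure.ofMeasurable_apply X hX]
  refine ⟨ENNReal.ofReal_ne_top, ?_⟩
  rw [ENNReal.toReal_ofReal (Complex.nonneg_iff.1 h0).1]
  exact Complex.ext rfl (Complex.nonneg_iff.1 h0).2

instance (E : POVM Ω H) (T : DensityOperator H) : IsProbabilityMeasure (E.outcomeMeasure T) := by
  refine ⟨?_⟩
  have h : E.effect Set.univ = 1 := E.univ'
  rw [POVM.outcomeMeasure, Measure.ofMeasurable_apply _ MeasurableSet.univ, h]
  change ENNReal.ofReal (opTrace T.op).re = 1
  simp [T.trace_eq_one]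

/-- `E` is a fuzzy version of `F` if for some Markov kernel `κ` from the outcomes of `F` to the
outcomes of `E` one has `p_T^E(X) = ∫ κ_x(X) dp_T^F(x)` for all measurable `X` and all states
`T`. -/
def POVM.IsFuzzyVersionOf {Ω₁ Ω₂ : Type*} [MeasurableSpace Ω₁] [MeasurableSpace Ω₂]
    (E : POVM Ω₁ H) (F : POVM Ω₂ H) : Prop :=
  ∃ κ : Kernel Ω₂ Ω₁, IsMarkovKernel κ ∧
    ∀ X, MeasurableSet X → ∀ T : DensityOperator H,
      E.outcomeMeasure T X = ∫⁻ x, κ x X ∂(F.outcomeMeasure T)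

end Observables

end Quantum

namespace Quantum

section PureStates

variable {H : Type*} [NormedAddCommGroup H] [InnerProductSpace ℂ H] [CompleteSpace H]

/-! In a pure state `φ`, a sharp observable gives the set `X` probability `‖E.effect X φ‖ ^ 2`, so
null sets are read off from annihilated vectors. If `P₁.effect X φ = 0`, the smearing integral
vanishes, hence `P₂` kills `φ` on `B X = {x | κ x X ≠ 0}`. Splitting vectors along `X` and `Xᶜ`
shows that `B X ∩ B Xᶜ` is `P₂`-null. Over a countable basis this yields one `P₂`-null set `N` off
which `κ x` is zero-one on basic open sets, hence concentrated at a point `Φ x`. Off `N`, `Φ ⁻¹' X`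
is `B X`; comparing `X` with `Xᶜ` then identifies the two projections. -/

lemma opTrace_rankOne_comp (φ : H) (A : H →L[ℂ] H) :
    opTrace (InnerProductSpace.rankOne ℂ φ φ ∘L A) = ⟪φ, A φ⟫_ℂ := by
  rw [opTrace, ← ContinuousLinearMap.adjoint_inner_left,
    ← ((stdBasis H).hasSum_inner_mul_inner (ContinuousLinearMap.adjoint A φ) φ).tsum_eq]
  refine tsum_congr fun i => ?_
  rw [ContinuousLinearMap.comp_apply, InnerProductSpace.rankOne_apply, inner_smul_right,
    ContinuousLinearMap.adjoint_inner_left]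

/-- The pure state given by a unit vector. -/
noncomputable def DensityOperator.pure (φ : H) (hφ : ‖φ‖ = 1) : DensityOperator H where
  op := InnerProductSpace.rankOne ℂ φ φ
  isPositive := InnerProductSpace.isPositive_rankOne_self φ
  trace_eq_one := by
    have h := opTrace_rankOne_comp φ (ContinuousLinearMap.id ℂ H)
    rw [ContinuousLinearMap.comp_id] at h
    rw [h, ContinuousLinearMap.id_apply, inner_self_eq_norm_sq_to_K, hφ]
    simp

/-- The pure state given by a nonzero vector, after normalization. -/
noncomputable def DensityOperator.ofVector (φ : H) (hφ : φ ≠ 0) : DensityOperator H :=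
  .pure (((‖φ‖ : ℂ))⁻¹ • φ) (norm_smul_inv_norm hφ)

end PureStates

namespace POVM

/-! ### Sharp effects and the vectors they annihilate -/

variable {Ω : Type*} [MeasurableSpace Ω]
  {H : Type*} [NormedAddCommGroup H] [InnerProductSpace ℂ H] [CompleteSpace H]

lemma effect_empty (E : POVM Ω H) : E.effect ∅ = 0 := by
  rw [effect, E.toVectorMeasure.empty]
  rfl

lemma effect_add_compl (E : POVM Ω H) {X : Set Ω} (hX : MeasurableSet X) :
    E.effect X + E.effect Xᶜ = 1 := by
  have h := VectorMeasure.of_union (v := E.toVectorMeasure) disjoint_compl_right hX hX.compl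
  rw [Set.union_compl_self] at h
  rw [← E.univ', h]
  rfl

lemma effect_apply_add_compl (E : POVM Ω H) {X : Set Ω} (hX : MeasurableSet X) (φ : H) :
    E.effect X φ + E.effect Xᶜ φ = φ :=
  congrArg (fun A : H →L[ℂ] H => A φ) (E.effect_add_compl hX)

lemma IsSharp.effect_apply_effect_compl {E : POVM Ω H} (hE : E.IsSharp) {X : Set Ω}
    (hX : MeasurableSet X) (φ : H) : E.effect X (E.effect Xᶜ φ) = 0 := by
  rw [← mul_apply_eq_comp, hE X Xᶜ hX hX.compl, Set.inter_compl_self, effect_empty,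
    zero_apply]

lemma IsSharp.inner_effect_self {E : POVM Ω H} (hE : E.IsSharp) {X : Set Ω}
    (hX : MeasurableSet X) (φ : H) : ⟪φ, E.effect X φ⟫_ℂ = (‖E.effect X φ‖ : ℂ) ^ 2 := by
  have h : E.effect X (E.effect X φ) = E.effect X φ := by
    have h := hE X X hX hX
    rw [Set.inter_self] at h
    exact congrArg (fun A : H →L[ℂ] H => A φ) h
  have h2 : ⟪E.effect X φ, E.effect X φ⟫_ℂ = ⟪φ, E.effect X (E.effect X φ)⟫_ℂ :=
    (E.isPositive X).isSymmetric _ _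
  rw [h, inner_self_eq_norm_sq_to_K] at h2
  exact h2.symm

lemma IsSharp.outcomeMeasure_pure_eq_zero_iff {E : POVM Ω H} (hE : E.IsSharp) {X : Set Ω}
    (hX : MeasurableSet X) {φ : H} (hφ : ‖φ‖ = 1) :
    E.outcomeMeasure (.pure φ hφ) X = 0 ↔ E.effect X φ = 0 := by
  rw [outcomeMeasure, Measure.ofMeasurable_apply X hX, DensityOperator.pure,
    opTrace_rankOne_comp, hE.inner_effect_self hX, ENNReal.ofReal_eq_zero, ← Complex.ofReal_pow,
    Complex.ofReal_re, sq_nonpos_iff, norm_eq_zero]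

lemma IsSharp.outcomeMeasure_ofVector_eq_zero_iff {E : POVM Ω H} (hE : E.IsSharp) {X : Set Ω}
    (hX : MeasurableSet X) {φ : H} (hφ : φ ≠ 0) :
    E.outcomeMeasure (.ofVector φ hφ) X = 0 ↔ E.effect X φ = 0 := by
  have hc : ((‖φ‖ : ℂ))⁻¹ ≠ 0 := by simpa using hφ
  rw [DensityOperator.ofVector, hE.outcomeMeasure_pure_eq_zero_iff hX, map_smul,
    smul_eq_zero_iff_right hc]

lemma IsSharp.effect_apply_eq_zero_of_subset {E : POVM Ω H} (hE : E.IsSharp) {X Y : Set Ω}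
    (hX : MeasurableSet X) (hY : MeasurableSet Y) (hXY : X ⊆ Y) {φ : H}
    (h : E.effect Y φ = 0) : E.effect X φ = 0 := by
  have h1 := hE X Y hX hY
  rw [Set.inter_eq_left.2 hXY] at h1
  rw [← h1, mul_apply_eq_comp, h, map_zero]

/-- Countable subadditivity of the outcome distribution in the state of `φ`; no disjointness is
needed. -/
lemma IsSharp.effect_iUnion_apply_eq_zero {ι : Type*} [Countable ι] {E : POVM Ω H}
    (hE : E.IsSharp) {X : ι → Set Ω} (hX : ∀ i, MeasurableSet (X i)) {φ : H}
    (h : ∀ i, E.effect (X i) φ = 0) : E.effect (⋃ i, X i) φ = 0 := by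
  rcases eq_or_ne φ 0 with rfl | hφ
  · exact map_zero _
  rw [← hE.outcomeMeasure_ofVector_eq_zero_iff (.iUnion hX) hφ]
  exact measure_iUnion_null fun i => (hE.outcomeMeasure_ofVector_eq_zero_iff (hX i) hφ).2 (h i)

lemma IsSharp.effect_union_apply_eq_zero {E : POVM Ω H} (hE : E.IsSharp) {X Y : Set Ω}
    (hX : MeasurableSet X) (hY : MeasurableSet Y) {φ : H} (h : E.effect X φ = 0)
    (h' : E.effect Y φ = 0) : E.effect (X ∪ Y) φ = 0 := by
  rw [Set.union_eq_iUnion]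
  exact hE.effect_iUnion_apply_eq_zero (by simp [hX, hY]) (by simp [h, h'])

/-! ### Sets charged by the smearing kernel -/

variable {Ω₁ Ω₂ : Type*} [MeasurableSpace Ω₁] [MeasurableSpace Ω₂]

lemma measurableSet_kernel_ne_zero (κ : Kernel Ω₂ Ω₁) {X : Set Ω₁} (hX : MeasurableSet X) :
    MeasurableSet {x | κ x X ≠ 0} :=
  (κ.measurable_coe hX (measurableSet_singleton 0)).compl

/-- A vector that is annihilated by `E X` is annihilated by the effect of the set where the
smearing kernel charges `X`. -/
lemma IsSharp.effect_kernel_ne_zero_apply {E : POVM Ω₁ H} {F : POVM Ω₂ H} (hE : E.IsSharp)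
    (hF : F.IsSharp) {κ : Kernel Ω₂ Ω₁}
    (h : ∀ X, MeasurableSet X → ∀ T : DensityOperator H,
      E.outcomeMeasure T X = ∫⁻ x, κ x X ∂(F.outcomeMeasure T))
    {X : Set Ω₁} (hX : MeasurableSet X) {φ : H} (hφ : E.effect X φ = 0) :
    F.effect {x | κ x X ≠ 0} φ = 0 := by
  rcases eq_or_ne φ 0 with rfl | hφ0
  · exact map_zero _
  rw [← hE.outcomeMeasure_ofVector_eq_zero_iff hX hφ0, h X hX,
    lintegral_eq_zero_iff (κ.measurable_coe hX)] at hφ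
  rw [← hF.outcomeMeasure_ofVector_eq_zero_iff (measurableSet_kernel_ne_zero κ hX) hφ0]
  exact hφ

/-- Each vector is a sum of one killed by `E.effect X` and one killed by `E.effect Xᶜ`; the two
factors of the intersection dispose of one summand each. Thus `κ x X` is almost surely 0 or 1 when
`κ` is Markov. -/
lemma IsSharp.effect_kernel_ne_zero_inter_compl {E : POVM Ω₁ H} {F : POVM Ω₂ H}
    (hE : E.IsSharp) (hF : F.IsSharp) {κ : Kernel Ω₂ Ω₁}
    (h : ∀ X, MeasurableSet X → ∀ T : DensityOperator H,
      E.outcomeMeasure T X = ∫⁻ x, κ x X ∂(F.outcomeMeasure T))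
    {X : Set Ω₁} (hX : MeasurableSet X) :
    F.effect ({x | κ x X ≠ 0} ∩ {x | κ x Xᶜ ≠ 0}) = 0 := by
  have hm := measurableSet_kernel_ne_zero κ hX
  have hm' := measurableSet_kernel_ne_zero κ hX.compl
  ext φ
  have h1 : F.effect ({x | κ x X ≠ 0} ∩ {x | κ x Xᶜ ≠ 0}) (E.effect Xᶜ φ) = 0 :=
    hF.effect_apply_eq_zero_of_subset (hm.inter hm') hm Set.inter_subset_left
      (hE.effect_kernel_ne_zero_apply hF h hX (hE.effect_apply_effect_compl hX φ))
  have h2 : F.effect ({x | κ x X ≠ 0} ∩ {x | κ x Xᶜ ≠ 0}) (E.effect X φ) = 0 :=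
    hF.effect_apply_eq_zero_of_subset (hm.inter hm') hm' Set.inter_subset_right
      (hE.effect_kernel_ne_zero_apply hF h hX.compl (by
        simpa using hE.effect_apply_effect_compl hX.compl φ))
  rw [← E.effect_apply_add_compl hX φ, map_add, h1, h2]
  simp

end POVM

end Quantum

/-- Second countability gives a point `y` all of whose neighbourhoods have positive measure. Basic
sets around `y` then have null complements, and by T1 these countably many complements cover `{y}ᶜ`.
-/
lemma MeasureTheory.exists_measure_compl_singleton_eq_zero {Ω : Type*} [TopologicalSpace Ω]
    [T1Space Ω] [SecondCountableTopology Ω] [MeasurableSpace Ω] (μ : Measure Ω) [NeZero μ]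
    (h : ∀ U ∈ TopologicalSpace.countableBasis Ω, μ U = 0 ∨ μ Uᶜ = 0) :
    ∃ y, μ {y}ᶜ = 0 := by
  obtain ⟨y, -, hy⟩ := exists_mem_forall_mem_nhdsWithin_pos_measure
    (μ := μ) (s := Set.univ) (by simpa using NeZero.ne μ)
  have hb := TopologicalSpace.isBasis_countableBasis Ω
  refine ⟨y, measure_mono_null (t := ⋃ U ∈ {U ∈ TopologicalSpace.countableBasis Ω | y ∈ U}, Uᶜ)
    (fun z hz => ?_) ?_⟩
  · obtain ⟨U, hU, hyU, hUz⟩ := hb.exists_subset_of_mem_open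
      (show y ∈ ({z}ᶜ : Set Ω) from fun hyz => hz hyz.symm) isOpen_compl_singleton
    exact Set.mem_biUnion (show U ∈ {U ∈ TopologicalSpace.countableBasis Ω | y ∈ U} from ⟨hU, hyU⟩)
      fun hzU => hUz hzU rfl
  · refine (measure_biUnion_null_iff
      ((TopologicalSpace.countable_countableBasis Ω).mono fun U hU => hU.1)).2 fun U hU => ?_
    refine (h U hU.1).resolve_left (hy U ?_).ne'
    rw [nhdsWithin_univ]
    exact (hb.isOpen hU.1).mem_nhds hU.2

theorem mainTheorem3
    {Ω₁ Ω₂ H : Type*}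
    [TopologicalSpace Ω₁] [T2Space Ω₁] [LocallyCompactSpace Ω₁] [SecondCountableTopology Ω₁]
    [MeasurableSpace Ω₁] [BorelSpace Ω₁]
    [TopologicalSpace Ω₂] [T2Space Ω₂] [LocallyCompactSpace Ω₂] [SecondCountableTopology Ω₂]
    [MeasurableSpace Ω₂] [BorelSpace Ω₂]
    [NormedAddCommGroup H] [InnerProductSpace ℂ H] [CompleteSpace H]
    [TopologicalSpace.SeparableSpace H]
    (P₁ : Quantum.POVM Ω₁ H) (P₂ : Quantum.POVM Ω₂ H)
    (hP₁ : P₁.IsSharp) (hP₂ : P₂.IsSharp)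
    (hfuzzy : P₁.IsFuzzyVersionOf P₂) :
    ∃ Φ : Ω₂ → Ω₁, Measurable Φ ∧
      ∀ X : Set Ω₁, MeasurableSet X → P₁.effect X = P₂.effect (Φ ⁻¹' X) := by
  classical
  obtain ⟨κ, hκ, h⟩ := hfuzzy
  let B (X : Set Ω₁) : Set Ω₂ := {x | κ x X ≠ 0}
  have hB {X : Set Ω₁} (hX : MeasurableSet X) : MeasurableSet (B X) :=
    Quantum.POVM.measurableSet_kernel_ne_zero κ hX
  let 𝒰 := TopologicalSpace.countableBasis Ω₁
  have : Countable 𝒰 := (TopologicalSpace.countable_countableBasis Ω₁).to_subtype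
  have h𝒰 (U : 𝒰) : MeasurableSet (U : Set Ω₁) :=
    ((TopologicalSpace.isBasis_countableBasis Ω₁).isOpen U.2).measurableSet
  let N : Set Ω₂ := ⋃ U : 𝒰, B U ∩ B (U : Set Ω₁)ᶜ
  have hN : MeasurableSet N := .iUnion fun U => (hB (h𝒰 U)).inter (hB (h𝒰 U).compl)
  have hN0 (φ : H) : P₂.effect N φ = 0 :=
    hP₂.effect_iUnion_apply_eq_zero (fun U => (hB (h𝒰 U)).inter (hB (h𝒰 U).compl)) fun U => by
      rw [hP₁.effect_kernel_ne_zero_inter_compl hP₂ h (h𝒰 U), zero_apply]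
  have hdirac (x : Ω₂) (hx : x ∉ N) : ∃ y, κ x {y}ᶜ = 0 := by
    refine exists_measure_compl_singleton_eq_zero _ fun U hU => ?_
    by_contra! hne
    exact hx (Set.mem_iUnion.2 ⟨⟨U, hU⟩, hne⟩)
  have hpt (x : Ω₂) : ∃ y, x ∉ N → κ x {y}ᶜ = 0 := by
    by_cases hx : x ∈ N
    -- On `N` any point will do; one exists since `κ x` has mass one.
    · exact ⟨(κ x).nonempty_of_neZero.some, fun hx' => absurd hx hx'⟩
    · exact (hdirac x hx).imp fun y hy _ => hy
  choose f hf using hpt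
  obtain hempty | ⟨⟨x₀⟩⟩ := isEmpty_or_nonempty Ω₂
  -- If `Ω₂` is empty, normalization forces `H` to be trivial.
  · have hH : (1 : H →L[ℂ] H) = 0 := by
      rw [← P₂.effect_empty, ← P₂.univ', Set.univ_eq_empty_iff.2 hempty]
      rfl
    refine ⟨f, measurable_of_empty f, fun X _ => ?_⟩
    exact eq_of_zero_eq_one hH.symm _ _
  -- The chosen `f` is uncontrolled on `N`; a constant value there secures measurability.
  let Φ : Ω₂ → Ω₁ := fun x => if x ∈ N then f x₀ else f x
  have hΦ {x : Ω₂} (hx : x ∉ N) {X : Set Ω₁} (hxX : Φ x ∉ X) : κ x X = 0 := by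
    have hfx : Φ x = f x := if_neg hx
    exact measure_mono_null (t := {f x}ᶜ)
      (fun y hy (hyx : y = f x) => hxX (by rw [hfx, ← hyx]; exact hy)) (hf x hx)
  have hΦpos {x : Ω₂} (hx : x ∉ N) {X : Set Ω₁} (hX : MeasurableSet X) (hxX : Φ x ∈ X) :
      κ x X ≠ 0 := fun h0 => by
    have hc : κ x Xᶜ = 0 := hΦ hx (not_not_intro hxX)
    rw [prob_compl_eq_zero_iff hX, h0] at hc
    exact zero_ne_one hc
  have hpre (X : Set Ω₁) (hX : MeasurableSet X) : MeasurableSet (Φ ⁻¹' X) := by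
    -- Off `N`, `κ x` lives on `{Φ x}`, so it charges `X` exactly when `Φ x ∈ X`.
    have : Φ ⁻¹' X = N.ite {_x | f x₀ ∈ X} (B X) := by
      ext x
      by_cases hx : x ∈ N
      · simp [Set.ite, Φ, hx]
      · simp only [Set.mem_preimage, Set.ite, Set.mem_union, Set.mem_inter_iff, hx, and_false,
          Set.mem_sdiff, not_false_eq_true, and_true, false_or]
        exact ⟨hΦpos hx hX, fun hB' => by_contra fun hxX => hB' (hΦ hx hxX)⟩
    rw [this]
    exact hN.ite (.const _) (hB hX)
  refine ⟨Φ, fun X hX => hpre X hX, fun X hX => ?_⟩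
  -- Holds because `Φ ⁻¹' X ⊆ N ∪ B X`.
  have hzero {X : Set Ω₁} (hX : MeasurableSet X) {φ : H} (hφ : P₁.effect X φ = 0) :
      P₂.effect (Φ ⁻¹' X) φ = 0 := by
    refine hP₂.effect_apply_eq_zero_of_subset (hpre X hX) (hN.union (hB hX)) (fun x hx => ?_)
      (hP₂.effect_union_apply_eq_zero hN (hB hX) (hN0 φ)
        (hP₁.effect_kernel_ne_zero_apply hP₂ h hX hφ))
    by_cases hxN : x ∈ N
    · exact .inl hxN
    · exact .inr (hΦpos hxN hX hx)
  ext φ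
  -- With `Q = P₂.effect (Φ ⁻¹' X)` and `P = P₁.effect X`: `h1` gives `Q φ = Q (P φ)`, while `h2`
  -- and `h3` give `Q (P φ) = P φ`.
  have h1 := hzero hX (hP₁.effect_apply_effect_compl hX φ)
  have h2 := hzero hX.compl (φ := P₁.effect X φ)
    (by simpa using hP₁.effect_apply_effect_compl hX.compl φ)
  have h3 := P₂.effect_apply_add_compl (hpre X hX) (P₁.effect X φ)
  rw [Set.preimage_compl] at h2
  rw [h2, add_zero] at h3
  rw [← h3]
  nth_rw 2 [← P₁.effect_apply_add_compl hX φ]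
  rw [map_add, h1, add_zero]
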